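/- All graphs are finite and simple. For a connected graph $G$ with $m=|E(G)|$ edges and vertex degrees $d_i$, let $\mathscr K(G)=\sum_j \pi_j m_{ij}$ be Kemeny's constant of the simple random walk on $G$, where $\pi$ is its stationary distribution and $m_{ij}$ is the expected time at which the walk started at $i$ first visits $j$ (so $m_{jj}=0$); the sum does not depend on $i$. Let $r_G(i,j)=(e_i-e_j)^TL^\dagger(e_i-e_j)$ be the effective resistance between $i$ and $j$, where $L^\dagger$ is the Moore–Penrose pseudoinverse of the Laplacian matrix of $G$, and let $\mu(G,v)=\sum_{i\in V(G)}d_i\,r_G(i,v)$ be the moment of the vertex $v$. A Braess set of $G$ is a set of non-edges of $G$ (pairs of distinct non-adjacent vertices) such that adding all of them to $G$ as edges strictly increases Kemeny's constant. **Corollary.** Let $G_1,G_2$ be connected graphs with $m_1$ and $m_2$ edges, and let $G=G_1\oplus_v G_2$ be the graph obtained from disjoint copies of $G_1$ and $G_2$ by identifying a vertex of $G_1$ with a vertex of $G_2$; the common vertex is called $v$. Let $\mathscr L$ be a set of $l$ non-edges of $G_2$, let $\widehat G_2$ be $G_2$ with the pairs in $\mathscr L$ added as edges, and put $$A=\mu(\widehat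 G_2,v)-\mu(G_2,v),\qquad B=\mathscr K(\widehat G_2)-\mu(G_2,v),\qquad C=\mathscr K(\widehat G_2)-\mathscr K(G_2).$$ If $$A m_1^2+\bigl((A+C)m_2+Bl\bigr)m_1+C\,(m_2^2+l\,m_2)>0,$$ then $\mathscr L$ is a Braess set of $G$. -/

import Mathlib

namespace KemenyBraess

/-! ### Finite Markov chains, hitting times and Kemeny's constant -/

section MarkovChain

variable {V : Type*} [Fintype V]

/-- The probability that the Markov chain with transition matrix `P`, started at `x 0`, visits
`x 0, x 1, …, x n` in this order during its first `n` steps. -/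
def pathProb (P : Matrix V V ℝ) (n : ℕ) (x : Fin (n + 1) → V) : ℝ :=
  ∏ t : Fin n, P (x t.castSucc) (x t.succ)

open Classical in
/-- The probability that the chain started at `i` is at `j` for the first time at time `n`, that is
`ℙ_i(T_j = n)` where `T_j = min {t ≥ 0 : X_t = j}`. -/
noncomputable def firstPassageProb (P : Matrix V V ℝ) (i j : V) (n : ℕ) : ℝ :=
  ∑ x : Fin (n + 1) → V with
    x 0 = i ∧ x (Fin.last n) = j ∧ ∀ t : Fin n, x t.castSucc ≠ j, pathProb P n x

/-- `m` is the hitting time of `j` from `i`: the chain started at `i` reaches `j` almost surely and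
`m` is the expectation of the (integer valued) time `T_j` at which it does so for the first time. -/
def IsHittingTime (P : Matrix V V ℝ) (i j : V) (m : ℝ) : Prop :=
  HasSum (fun n : ℕ => firstPassageProb P i j n) 1 ∧
    HasSum (fun n : ℕ => (n : ℝ) * firstPassageProb P i j n) m

/-- `π` is a stationary probability distribution of the chain. -/
def IsStationary (P : Matrix V V ℝ) (π : V → ℝ) : Prop :=
  π ∈ stdSimplex ℝ V ∧ Matrix.vecMul π P = π

/-- `κ` is Kemeny's constant of the chain: `∑ j, π j * m i j = κ` for every initial state `i`,
where `π` is the stationary distribution and `m i j` is the hitting time of `j` from `i`. -/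
def IsKemenyConstant (P : Matrix V V ℝ) (κ : ℝ) : Prop :=
  ∃ (π : V → ℝ) (m : V → V → ℝ), IsStationary P π ∧ (∀ i j, IsHittingTime P i j (m i j)) ∧
    ∀ i, ∑ j, π j * m i j = κ

end MarkovChain

/-! ### The random walk on a graph, effective resistance and moments -/

section Graph

variable {V : Type*} [Fintype V]

open Classical in
/-- The transition matrix of the simple random walk on `G`: a step goes to a uniformly chosen
neighbour. (At an isolated vertex there is none, and the walk stays where it is; in a connected
graph this happens only if the graph has one vertex.) -/
noncomputable def walkMatrix (G : SimpleGraph V) : Matrix V V ℝ := fun i j =>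
  if G.degree i = 0 then (if i = j then 1 else 0)
  else if G.Adj i j then 1 / (G.degree i : ℝ) else 0

/-- Kemeny's constant of a graph, that is, of the simple random walk on it. -/
noncomputable def kemeny (G : SimpleGraph V) : ℝ :=
  Classical.epsilon fun κ : ℝ => IsKemenyConstant (walkMatrix G) κ

/-- The four Penrose equations: `X` is the Moore–Penrose pseudoinverse of the real matrix `A`. -/
def IsMoorePenrose (A X : Matrix V V ℝ) : Prop :=
  A * X * A = A ∧ X * A * X = X ∧ (A * X).transpose = A * X ∧ (X * A).transpose = X * A

/-- The Moore–Penrose pseudoinverse of a real square matrix. -/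
noncomputable def pinv (A : Matrix V V ℝ) : Matrix V V ℝ :=
  Classical.epsilon fun X : Matrix V V ℝ => IsMoorePenrose A X

open Classical in
/-- The effective resistance `(e_i - e_j)ᵀ L† (e_i - e_j)`, with `L` the Laplacian of `G`. -/
noncomputable def effRes (G : SimpleGraph V) (i j : V) : ℝ :=
  let u : V → ℝ := Pi.single i 1 - Pi.single j 1
  u ⬝ᵥ Matrix.mulVec (pinv (G.lapMatrix ℝ)) u

open Classical in
/-- The moment `μ(G, v) = ∑ i, d_i r_G(i, v)`. -/
noncomputable def moment (G : SimpleGraph V) (v : V) : ℝ :=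
  ∑ i, (G.degree i : ℝ) * effRes G i v

/-- The graph obtained from `G` by adding the pairs in `S` as edges. -/
def addEdges {V : Type*} (G : SimpleGraph V) (S : Set (Sym2 V)) : SimpleGraph V :=
  G ⊔ SimpleGraph.fromEdgeSet S

/-- A Braess set of `G`: a set of non-edges of `G` whose addition to `G` increases Kemeny's
constant. -/
def IsBraessSet (G : SimpleGraph V) (S : Set (Sym2 V)) : Prop :=
  S ⊆ Gᶜ.edgeSet ∧ kemeny G < kemeny (addEdges G S)

end Graph

/-! ### The 1-sum of two graphs -/

section OneSum

variable {V₁ V₂ : Type*}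

open Classical in
/-- The map of the vertices of `G₁` into the vertices of the 1-sum, with `v₁` replaced by `v₂`. -/
noncomputable def glueLeft (v₁ : V₁) (v₂ : V₂) (x : V₁) : {x : V₁ // x ≠ v₁} ⊕ V₂ :=
  if h : x = v₁ then Sum.inr v₂ else Sum.inl ⟨x, h⟩

/-- The 1-sum of `G₁` and `G₂` at `v₁` and `v₂`: take a copy of each, remove `v₁`, and replace every
edge `{i, v₁}` of `G₁` with `{i, v₂}`. -/
noncomputable def oneSum (G₁ : SimpleGraph V₁) (v₁ : V₁) (G₂ : SimpleGraph V₂) (v₂ : V₂) :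
    SimpleGraph ({x : V₁ // x ≠ v₁} ⊕ V₂) :=
  G₁.map (glueLeft v₁ v₂) ⊔ G₂.map Sum.inr

/-- A set of pairs of vertices of `G₂`, viewed as pairs of vertices of the 1-sum. -/
def liftPairs (v₁ : V₁) (S : Set (Sym2 V₂)) : Set (Sym2 ({x : V₁ // x ≠ v₁} ⊕ V₂)) :=
  Sym2.map Sum.inr '' S

end OneSum

end KemenyBraess

/-! Write `K` for Kemeny's constant and `μ` for the moment at the glued vertex. With `vol = 2m`, a
potential argument gives `2 vol K = ∑ d_i d_j r(i,j)`. In a 1-sum, resistances within a summand are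
unchanged and those across the cut vertex add, so this double sum splits into `(m₁+m₂) K(G) = m₁
K(G₁) + m₂ K(G₂) + m₂ μ(G₁) + m₁ μ(G₂)` (`volume_mul_kemeny_oneSum`). Adding edges inside `G₂`
commutes with gluing, so the formula applies before and after. The difference of the two constants,
times `(m₁+m₂)(m₁+m₂+l)`, is the polynomial of the hypothesis plus `l m₁ (μ(G₁) - K(G₁))`. This
remainder is nonnegative: by the commute-time identity `hit_add_hit`, the moment majorizes Kemeny's
constant (`volume_mul_kemeny_le_moment`). The probabilistic definitions enter through
`isHittingTime_of_firstStep`, which identifies hitting times as solutions of linear equations. -/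

namespace KemenyBraess

/-! ### First-passage probabilities and the first-step equations. -/

section HittingTimes

variable {V : Type*} [Fintype V]

open Classical in
theorem firstPassageProb_zero (P : Matrix V V ℝ) (i j : V) :
    firstPassageProb P i j 0 = if i = j then 1 else 0 := by
  unfold firstPassageProb pathProb
  rw [Finset.sum_filter, Fintype.sum_eq_single (fun _ => i)]
  · simp
  · intro x hx
    rw [if_neg]
    rintro ⟨h0, -⟩
    apply hx
    funext t
    rw [show t = 0 from Fin.ext (by omega), h0]

theorem firstPassageProb_succ_self (P : Matrix V V ℝ) (j : V) (n : ℕ) :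
    firstPassageProb P j j (n + 1) = 0 := by
  unfold firstPassageProb
  rw [Finset.sum_eq_zero]
  intro x hx
  simp only [Finset.mem_filter, Finset.mem_univ, true_and] at hx
  exact absurd hx.1 (hx.2.2 0)

theorem firstPassageProb_succ (P : Matrix V V ℝ) {i j : V} (hij : i ≠ j) (n : ℕ) :
    firstPassageProb P i j (n + 1) = ∑ k, P i k * firstPassageProb P k j n := by
  classical
  unfold firstPassageProb
  simp only [Finset.sum_filter, Finset.mul_sum]
  rw [Finset.sum_comm, ← (Fin.consEquiv (fun _ : Fin (n + 2) => V)).sum_comp,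
    Fintype.sum_prod_type, Finset.sum_comm]
  refine Finset.sum_congr rfl fun y _ => ?_
  -- Only head `i` and first step `k = y 0` contribute; avoiding `j` at time 0 is automatic since `i
  -- ≠ j`.
  rw [Fintype.sum_eq_single i, Fintype.sum_eq_single (y 0)]
  · have h1 : Fin.last (n + 1) = (Fin.last n).succ := rfl
    simp only [Fin.consEquiv_apply, Fin.cons_zero, h1, Fin.cons_succ, true_and,
      Fin.forall_fin_succ (n := n), Fin.castSucc_zero, Fin.castSucc_succ, pathProb,
      Fin.prod_univ_succ (n := n), ne_eq, hij, not_false_eq_true, mul_ite, mul_zero]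
  · intro k hk
    rw [if_neg (fun h => hk h.1.symm), mul_zero]
  · intro a ha
    exact if_neg fun h => ha h.1

theorem firstPassageProb_nonneg {P : Matrix V V ℝ} (hP : ∀ i k, 0 ≤ P i k) (i j : V) (n : ℕ) :
    0 ≤ firstPassageProb P i j n :=
  Finset.sum_nonneg fun _ _ => Finset.prod_nonneg fun _ _ => hP _ _

theorem sum_firstPassageProb_le_one {P : Matrix V V ℝ} (hP : ∀ i k, 0 ≤ P i k)
    (hP1 : ∀ i, ∑ k, P i k = 1) (j : V) (N : ℕ) (i : V) :
    ∑ n ∈ Finset.range N, firstPassageProb P i j n ≤ 1 := by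
  classical
  induction N generalizing i with
  | zero => simp
  | succ N ih =>
    rw [Finset.sum_range_succ']
    by_cases hij : i = j
    · subst hij
      simp [firstPassageProb_succ_self, firstPassageProb_zero]
    · simp only [firstPassageProb_succ P hij, firstPassageProb_zero, hij, if_false, add_zero]
      rw [Finset.sum_comm]
      simp only [← Finset.mul_sum]
      calc _ ≤ ∑ k, P i k * 1 := Finset.sum_le_sum fun k _ => mul_le_mul_of_nonneg_left (ih k) (hP i k)
        _ = 1 := by simp [hP1]

/-- Any nonnegative solution off `j` dominates the truncated expectations, which makes the
expectation series summable. The start varies in the induction because the first step moves it. -/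
theorem sum_mul_firstPassageProb_le {P : Matrix V V ℝ} (hP : ∀ i k, 0 ≤ P i k)
    (hP1 : ∀ i, ∑ k, P i k = 1) {j : V} {h : V → ℝ} (h0 : ∀ i, 0 ≤ h i)
    (hh : ∀ i, i ≠ j → h i = 1 + ∑ k, P i k * h k) (N : ℕ) (i : V) :
    ∑ n ∈ Finset.range N, (n : ℝ) * firstPassageProb P i j n ≤ h i := by
  classical
  induction N generalizing i with
  | zero => simpa using h0 i
  | succ N ih =>
    rw [Finset.sum_range_succ']
    by_cases hij : i = j
    · subst hij
      simpa [firstPassageProb_succ_self] using h0 i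
    -- The weight `n + 1` splits into the time after the first step plus the first step itself.
    · have key : ∑ n ∈ Finset.range N, ((n + 1 : ℕ) : ℝ) * firstPassageProb P i j (n + 1)
          = ∑ k, P i k * (∑ n ∈ Finset.range N, (n : ℝ) * firstPassageProb P k j n)
            + ∑ k, P i k * ∑ n ∈ Finset.range N, firstPassageProb P k j n := by
        simp only [firstPassageProb_succ P hij, Finset.mul_sum]
        rw [Finset.sum_comm, ← Finset.sum_add_distrib]
        refine Finset.sum_congr rfl fun k _ => ?_
        rw [← Finset.sum_add_distrib]
        refine Finset.sum_congr rfl fun n _ => ?_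
        push_cast
        ring
      rw [key, hh i hij]
      have a1 : ∑ k, P i k * (∑ n ∈ Finset.range N, (n : ℝ) * firstPassageProb P k j n)
          ≤ ∑ k, P i k * h k :=
        Finset.sum_le_sum fun k _ => mul_le_mul_of_nonneg_left (ih k) (hP i k)
      have a2 : ∑ k, P i k * ∑ n ∈ Finset.range N, firstPassageProb P k j n ≤ ∑ k, P i k * 1 :=
        Finset.sum_le_sum fun k _ => mul_le_mul_of_nonneg_left
          (sum_firstPassageProb_le_one hP hP1 j N k) (hP i k)
      simp only [mul_one, hP1] at a2
      simp only [Nat.cast_zero, zero_mul, add_zero]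
      linarith

/-- A nonnegative solution of the first-step equations is the vector of hitting times, provided
that those equations determine their solution. -/
theorem isHittingTime_of_firstStep {P : Matrix V V ℝ} (hP : ∀ i k, 0 ≤ P i k)
    (hP1 : ∀ i, ∑ k, P i k = 1) {j : V}
    (huniq : ∀ u : V → ℝ, u j = 0 → (∀ i, i ≠ j → u i = ∑ k, P i k * u k) → ∀ i, u i = 0)
    {h : V → ℝ} (h0 : ∀ i, 0 ≤ h i) (hj : h j = 0)
    (hh : ∀ i, i ≠ j → h i = 1 + ∑ k, P i k * h k) (i : V) :
    IsHittingTime P i j (h i) := by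
  classical
  have s0 : ∀ i, Summable fun n : ℕ => firstPassageProb P i j n := fun i =>
    summable_of_sum_range_le (fun n => firstPassageProb_nonneg hP i j n)
      (fun N => sum_firstPassageProb_le_one hP hP1 j N i)
  have s1 : ∀ i, Summable fun n : ℕ => (n : ℝ) * firstPassageProb P i j n := fun i =>
    summable_of_sum_range_le
      (fun n => mul_nonneg n.cast_nonneg (firstPassageProb_nonneg hP i j n))
      (fun N => sum_mul_firstPassageProb_le hP hP1 h0 hh N i)
  have t0 : ∀ i, ∑' n : ℕ, firstPassageProb P i j n = 1 := by
    intro i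
    -- The defect of the total mass is harmonic off `j` and vanishes at `j`; the expectations below
    -- are treated likewise.
    have := huniq (fun i => (∑' n : ℕ, firstPassageProb P i j n) - 1) ?_ ?_ i
    · exact sub_eq_zero.1 this
    · rw [(s0 j).tsum_eq_zero_add]
      simp [firstPassageProb_succ_self, firstPassageProb_zero]
    · intro i hij
      rw [(s0 i).tsum_eq_zero_add]
      simp only [firstPassageProb_succ P hij, firstPassageProb_zero, hij, if_false, zero_add]
      rw [Summable.tsum_finsetSum (fun k _ => (s0 k).mul_left _)]
      simp only [tsum_mul_left, mul_sub, mul_one, Finset.sum_sub_distrib, hP1]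
  have t1 : ∀ i, ∑' n : ℕ, (n : ℝ) * firstPassageProb P i j n = h i := by
    intro i
    have := huniq (fun i => (∑' n : ℕ, (n : ℝ) * firstPassageProb P i j n) - h i) ?_ ?_ i
    · exact sub_eq_zero.1 this
    · rw [(s1 j).tsum_eq_zero_add]
      simp [firstPassageProb_succ_self, hj]
    · intro i hij
      rw [(s1 i).tsum_eq_zero_add]
      have key : ∀ n : ℕ, ((n + 1 : ℕ) : ℝ) * firstPassageProb P i j (n + 1) =
          ∑ k, (P i k * ((n : ℝ) * firstPassageProb P k j n) + P i k * firstPassageProb P k j n) := by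
        intro n
        rw [firstPassageProb_succ P hij, Finset.mul_sum]
        refine Finset.sum_congr rfl fun k _ => ?_
        push_cast
        ring
      simp only [key, Nat.cast_zero, zero_mul, zero_add]
      rw [Summable.tsum_finsetSum (fun k _ => ((s1 k).mul_left _).add ((s0 k).mul_left _))]
      simp only [((s1 _).mul_left _).tsum_add ((s0 _).mul_left _), tsum_mul_left, t0, mul_one,
        Finset.sum_add_distrib, hP1, mul_sub, Finset.sum_sub_distrib]
      rw [hh i hij]
      ring
  exact ⟨t0 i ▸ (s0 i).hasSum, t1 i ▸ (s1 i).hasSum⟩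

end HittingTimes

end KemenyBraess

namespace KemenyBraess

open Classical Matrix

/-! ### Laplacian potentials, effective resistance and the minimum principle. -/

section Potential

variable {V : Type*} [Fintype V] {G : SimpleGraph V}

theorem lapMatrix_mulVec_eq_sum (G : SimpleGraph V) (y : V → ℝ) (i : V) :
    (G.lapMatrix ℝ *ᵥ y) i = ∑ k ∈ G.neighborFinset i, (y i - y k) := by
  rw [SimpleGraph.lapMatrix_mulVec_apply, Finset.sum_sub_distrib, Finset.sum_const,
    SimpleGraph.card_neighborFinset_eq_degree, nsmul_eq_mul]

theorem lapMatrix_dotProduct_comm (G : SimpleGraph V) (x y : V → ℝ) :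
    x ⬝ᵥ G.lapMatrix ℝ *ᵥ y = (G.lapMatrix ℝ *ᵥ x) ⬝ᵥ y := by
  rw [dotProduct_mulVec, ← mulVec_transpose, (G.isSymm_lapMatrix (R := ℝ)).eq]

theorem sum_lapMatrix_mulVec (G : SimpleGraph V) (y : V → ℝ) :
    ∑ i, (G.lapMatrix ℝ *ᵥ y) i = 0 := by
  have h := lapMatrix_dotProduct_comm G (fun _ => 1) y
  rw [SimpleGraph.lapMatrix_mulVec_const_eq_zero, zero_dotProduct] at h
  simpa [dotProduct] using h

/-- The square matrix all of whose entries are `1`. -/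
def allOnes (V : Type*) : Matrix V V ℝ := fun _ _ => 1

theorem allOnes_mulVec (y : V → ℝ) : allOnes V *ᵥ y = fun _ => ∑ k, y k := by
  ext i
  simp [allOnes, mulVec, dotProduct]

theorem allOnes_mul_allOnes : allOnes V * allOnes V = (Fintype.card V : ℝ) • allOnes V := by
  ext i j
  simp [allOnes, Matrix.mul_apply]

theorem transpose_allOnes {W : Type*} : (allOnes W)ᵀ = allOnes W := rfl

theorem lapMatrix_mul_allOnes (G : SimpleGraph V) : G.lapMatrix ℝ * allOnes V = 0 := by
  ext i j
  exact congrFun (G.lapMatrix_mulVec_const_eq_zero (R := ℝ)) i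

theorem allOnes_mul_lapMatrix (G : SimpleGraph V) : allOnes V * G.lapMatrix ℝ = 0 := by
  have h := congrArg transpose (lapMatrix_mul_allOnes G)
  rwa [transpose_mul, transpose_allOnes, (G.isSymm_lapMatrix (R := ℝ)).eq, transpose_zero] at h

/-- The inverse of the Laplacian shifted by the all-ones matrix. -/
noncomputable def green (G : SimpleGraph V) : Matrix V V ℝ := (G.lapMatrix ℝ + allOnes V)⁻¹

theorem green_symm (G : SimpleGraph V) (i j : V) : green G i j = green G j i := by
  have h : (green G)ᵀ = green G := by
    rw [green, transpose_nonsing_inv, transpose_add, (G.isSymm_lapMatrix (R := ℝ)).eq,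
      transpose_allOnes]
  exact congrFun (congrFun h j) i

/-- For `y` in the kernel, summing coordinates kills the Laplacian part, so `∑ y = 0`. Then `L y =
0`, hence `y` is constant by connectedness, hence zero. -/
theorem isUnit_det_lapMatrix_add_allOnes (hG : G.Connected) :
    IsUnit (G.lapMatrix ℝ + allOnes V).det := by
  rw [← Matrix.isUnit_iff_isUnit_det, ← Matrix.mulVec_injective_iff_isUnit]
  refine (injective_iff_map_eq_zero (G.lapMatrix ℝ + allOnes V).mulVecLin).2 fun y hy => ?_
  have := hG.nonempty
  have hc : (Fintype.card V : ℝ) ≠ 0 := by exact_mod_cast Fintype.card_ne_zero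
  rw [mulVecLin_apply, add_mulVec, allOnes_mulVec] at hy
  have hs : ∑ k, y k = 0 := by
    have h1 := congrArg (fun z : V → ℝ => ∑ i, z i) hy
    simp only [Pi.add_apply, Finset.sum_add_distrib, sum_lapMatrix_mulVec, zero_add,
      Finset.sum_const, Finset.card_univ, nsmul_eq_mul, Pi.zero_apply, mul_zero] at h1
    exact (mul_eq_zero.1 h1).resolve_left hc
  have hL : G.lapMatrix ℝ *ᵥ y = 0 := by
    rw [hs] at hy
    simpa [← Pi.zero_def] using hy
  rw [SimpleGraph.lapMatrix_mulVec_eq_zero_iff_forall_reachable] at hL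
  ext i
  have h2 : ∑ k, y k = Fintype.card V * y i := by
    rw [Finset.sum_congr rfl fun k _ => hL k i (hG.preconnected k i)]
    simp
  rw [hs] at h2
  exact (mul_eq_zero.1 h2.symm).resolve_left hc

theorem lapMatrix_mul_green (hG : G.Connected) :
    G.lapMatrix ℝ * green G = 1 - (Fintype.card V : ℝ)⁻¹ • allOnes V := by
  have := hG.nonempty
  have hc : (Fintype.card V : ℝ) ≠ 0 := by exact_mod_cast Fintype.card_ne_zero
  have h1 : (G.lapMatrix ℝ + allOnes V) * green G = 1 :=
    mul_nonsing_inv _ (isUnit_det_lapMatrix_add_allOnes hG)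
  have h2 : allOnes V * green G = (Fintype.card V : ℝ)⁻¹ • allOnes V := by
    have h3 := congrArg (allOnes V * ·) h1
    simp only [← Matrix.mul_assoc, Matrix.mul_add, allOnes_mul_lapMatrix, zero_add, mul_one,
      allOnes_mul_allOnes, Matrix.smul_mul] at h3
    rw [eq_inv_smul_iff₀ hc, h3]
  rw [← h2, ← h1, add_mul, add_sub_cancel_right]

theorem lapMatrix_mulVec_green (hG : G.Connected) {u : V → ℝ} (hu : ∑ k, u k = 0) :
    G.lapMatrix ℝ *ᵥ (green G *ᵥ u) = u := by
  rw [mulVec_mulVec, lapMatrix_mul_green hG, sub_mulVec, smul_mulVec, allOnes_mulVec, hu]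
  ext i
  simp

/-- `green` has eigenvalue `1/n` on constants, where the pseudoinverse must vanish; subtracting
`n⁻²` times the all-ones matrix removes it. Existence is all that is needed for `pinv` to satisfy
the Penrose equations. -/
theorem isMoorePenrose_green (hG : G.Connected) :
    IsMoorePenrose (G.lapMatrix ℝ)
      (green G - ((Fintype.card V : ℝ)⁻¹ * (Fintype.card V : ℝ)⁻¹) • allOnes V) := by
  have := hG.nonempty
  have hc : (Fintype.card V : ℝ) ≠ 0 := by exact_mod_cast Fintype.card_ne_zero
  set c : ℝ := (Fintype.card V : ℝ)⁻¹ with hcdef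
  have hLN := lapMatrix_mul_green hG
  have hgt : (green G)ᵀ = green G := by
    ext i j
    exact green_symm G j i
  have hNL : green G * G.lapMatrix ℝ = 1 - c • allOnes V := by
    have h := congrArg transpose hLN
    rwa [transpose_mul, hgt, (G.isSymm_lapMatrix (R := ℝ)).eq, transpose_sub, transpose_one,
      transpose_smul, transpose_allOnes] at h
  have hJN : allOnes V * green G = c • allOnes V := by
    have h1 : (G.lapMatrix ℝ + allOnes V) * green G = 1 :=
      mul_nonsing_inv _ (isUnit_det_lapMatrix_add_allOnes hG)
    rw [add_mul, hLN] at h1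
    calc allOnes V * green G = (1 - c • allOnes V + allOnes V * green G) - 1 + c • allOnes V := by
          abel
      _ = c • allOnes V := by rw [h1]; abel
  have hLX : G.lapMatrix ℝ * (green G - (c * c) • allOnes V) = 1 - c • allOnes V := by
    rw [mul_sub, Matrix.mul_smul, lapMatrix_mul_allOnes, smul_zero, sub_zero, hLN]
  have hXL : (green G - (c * c) • allOnes V) * G.lapMatrix ℝ = 1 - c • allOnes V := by
    rw [sub_mul, Matrix.smul_mul, allOnes_mul_lapMatrix, smul_zero, sub_zero, hNL]
  have ht : (1 - c • allOnes V)ᵀ = 1 - c • allOnes V := by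
    rw [transpose_sub, transpose_one, transpose_smul, transpose_allOnes]
  refine ⟨?_, ?_, ?_, ?_⟩
  · rw [hLX, sub_mul, Matrix.one_mul, Matrix.smul_mul, allOnes_mul_lapMatrix, smul_zero, sub_zero]
  · have hcc : c * c * c * (Fintype.card V : ℝ) = c * c := by
      rw [mul_assoc, hcdef, inv_mul_cancel₀ hc, mul_one]
    rw [hXL, sub_mul, Matrix.one_mul, Matrix.smul_mul, mul_sub, hJN, Matrix.mul_smul,
      allOnes_mul_allOnes, smul_sub, smul_smul, smul_smul, smul_smul, ← mul_assoc,
      hcc, sub_self, sub_zero]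
  · rw [hLX, ht]
  · rw [hXL, ht]

/-- With `u = L y`, the equation `L L† L = L` gives `uᵀ L† u = yᵀ L y = yᵀ u`, so any potential
computes the resistance. -/
theorem effRes_eq_of_potential (hG : G.Connected) {i j : V} {y : V → ℝ}
    (hy : G.lapMatrix ℝ *ᵥ y = Pi.single i 1 - Pi.single j 1) : effRes G i j = y i - y j := by
  have hX : IsMoorePenrose (G.lapMatrix ℝ) (pinv (G.lapMatrix ℝ)) :=
    Classical.epsilon_spec ⟨_, isMoorePenrose_green hG⟩
  unfold effRes
  simp only
  rw [← hy, ← lapMatrix_dotProduct_comm, mulVec_mulVec, mulVec_mulVec, hX.1, hy,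
    dotProduct_sub, dotProduct_single_one, dotProduct_single_one]

theorem exists_potential (hG : G.Connected) (i j : V) :
    ∃ y : V → ℝ, G.lapMatrix ℝ *ᵥ y = Pi.single i 1 - Pi.single j 1 :=
  ⟨_, lapMatrix_mulVec_green hG (by simp)⟩

theorem effRes_eq_green (hG : G.Connected) (i j : V) :
    effRes G i j = green G i i + green G j j - 2 * green G i j := by
  rw [effRes_eq_of_potential hG (lapMatrix_mulVec_green hG (by simp)), mulVec_sub,
    mulVec_single_one, mulVec_single_one]
  simp only [Pi.sub_apply, col_apply, green_symm G j i]
  ring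

/-- Minimum principle: at a minimizer other than `j` all neighbours share the minimum, so a negative
minimum would spread along a walk to `j`. -/
theorem nonneg_of_superharmonic (hG : G.Connected) {h : V → ℝ} {j : V} (hj : 0 ≤ h j)
    (hs : ∀ i, i ≠ j → 0 ≤ (G.lapMatrix ℝ *ᵥ h) i) (i : V) : 0 ≤ h i := by
  have := hG.nonempty
  obtain ⟨a, ha⟩ := Finite.exists_min h
  refine le_trans ?_ (ha i)
  by_contra! hneg
  have key : ∀ b, G.Reachable a b → h b = h a := by
    rintro b ⟨w⟩
    induction w using SimpleGraph.Walk.concatRec with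
    | Hnil => rfl
    | Hconcat p hadj ih =>
      rename_i u v w
      have hv := ih ha hneg
      have hvj : v ≠ j := by
        rintro rfl
        linarith
      have h1 := hs v hvj
      rw [lapMatrix_mulVec_eq_sum] at h1
      have h2 := Finset.sum_eq_zero_iff_of_nonpos (s := G.neighborFinset v)
        (f := fun k => h v - h k) (fun k _ => by have := ha k; linarith)
      have h3 := h2.1 (le_antisymm (Finset.sum_nonpos fun k _ => by have := ha k; linarith) h1) w
        (by simpa using hadj)
      linarith
  have := key j (hG.preconnected a j)
  linarith

end Potential

/-! ### Hitting times, Kemeny's constant and commute times of the walk. -/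

section Walk

variable {V : Type*} [Fintype V] {G : SimpleGraph V}

/-- The sum of the vertex degrees. -/
noncomputable def volume (G : SimpleGraph V) : ℝ := ∑ i, (G.degree i : ℝ)

/-- The hitting time of `j` from `i` for the simple random walk, in terms of `green`. -/
noncomputable def hit (G : SimpleGraph V) (i j : V) : ℝ :=
  ∑ k, (G.degree k : ℝ) * (green G i k - green G i j - green G j k + green G j j)

theorem hit_self (j : V) : hit G j j = 0 :=
  Finset.sum_eq_zero fun k _ => by ring

/-- The vector `u = d - vol · e_j` has sum zero, so `green G *ᵥ u` has Laplacian `u`; `hit` is this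
potential normalized to vanish at `j`. Off `j`, dividing by the degree yields the first-step
equation. -/
theorem lapMatrix_mulVec_hit (hG : G.Connected) {i j : V} (hij : i ≠ j) :
    (G.lapMatrix ℝ *ᵥ fun i => hit G i j) i = G.degree i := by
  set u : V → ℝ := (fun k => (G.degree k : ℝ)) - Pi.single j (volume G) with hu
  have h0 : ∑ k, u k = 0 := by simp [hu, volume]
  have hNu : ∀ i, (green G *ᵥ u) i = ∑ k, (G.degree k : ℝ) * (green G i k - green G i j) := by
    intro i
    rw [hu, mulVec_sub, Pi.sub_apply, mulVec_single, Pi.smul_apply, col_apply,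
      MulOpposite.smul_eq_mul_unop, MulOpposite.unop_op, volume, Finset.mul_sum, mulVec, dotProduct,
      ← Finset.sum_sub_distrib]
    exact Finset.sum_congr rfl fun k _ => by ring
  have h1 : (fun i => hit G i j) = green G *ᵥ u - fun _ => (green G *ᵥ u) j := by
    ext i
    rw [Pi.sub_apply, hNu, hNu, hit, ← Finset.sum_sub_distrib]
    exact Finset.sum_congr rfl fun k _ => by ring
  have h2 : (G.lapMatrix ℝ *ᵥ fun _ => (green G *ᵥ u) j) = 0 := by
    ext i
    simp [lapMatrix_mulVec_eq_sum]
  rw [h1, mulVec_sub, h2, sub_zero, lapMatrix_mulVec_green hG h0]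
  simp [hu, hij]

theorem hit_nonneg (hG : G.Connected) (i j : V) : 0 ≤ hit G i j :=
  nonneg_of_superharmonic (h := fun i => hit G i j) hG (hit_self j).ge
    (fun i hij => by rw [lapMatrix_mulVec_hit hG hij]; positivity) i

theorem walkMatrix_apply {i : V} (hd : G.degree i ≠ 0) (k : V) :
    walkMatrix G i k = if G.Adj i k then 1 / (G.degree i : ℝ) else 0 := by
  unfold walkMatrix
  rw [if_neg hd]

theorem sum_walkMatrix_mul {i : V} (hd : G.degree i ≠ 0) (f : V → ℝ) :
    ∑ k, walkMatrix G i k * f k = f i - (G.lapMatrix ℝ *ᵥ f) i / G.degree i := by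
  have hd' : (G.degree i : ℝ) ≠ 0 := by exact_mod_cast hd
  rw [SimpleGraph.lapMatrix_mulVec_apply]
  have : ∑ k, walkMatrix G i k * f k = (∑ k ∈ G.neighborFinset i, f k) / G.degree i := by
    simp only [walkMatrix_apply hd, SimpleGraph.neighborFinset_eq_filter, Finset.sum_filter,
      Finset.sum_div]
    refine Finset.sum_congr rfl fun k _ => ?_
    split_ifs <;> ring
  rw [this]
  field_simp
  ring

theorem isHittingTime_hit (hG : G.Connected) (hd : ∀ i, G.degree i ≠ 0) (i j : V) :
    IsHittingTime (walkMatrix G) i j (hit G i j) := by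
  have hd' : ∀ i, (G.degree i : ℝ) ≠ 0 := fun i => by exact_mod_cast hd i
  refine isHittingTime_of_firstStep (h := fun i => hit G i j) ?_ ?_ ?_
    (fun i => hit_nonneg hG i j) (hit_self j) ?_ i
  · intro i k
    rw [walkMatrix_apply (hd i)]
    split_ifs <;> positivity
  · intro i
    have h := sum_walkMatrix_mul (hd i) (fun _ => 1)
    simpa [lapMatrix_mulVec_eq_sum] using h
  · intro u hj hu i
    have hL : ∀ i, i ≠ j → (G.lapMatrix ℝ *ᵥ u) i = 0 := by
      intro i hij
      have h := hu i hij
      rw [sum_walkMatrix_mul (hd i)] at h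
      have h1 : (G.lapMatrix ℝ *ᵥ u) i / G.degree i = 0 := by linarith
      exact (div_eq_zero_iff.1 h1).resolve_right (hd' i)
    -- Uniqueness is the minimum principle applied to both `u` and `-u`.
    refine le_antisymm ?_ (nonneg_of_superharmonic hG hj.ge (fun i hij => (hL i hij).ge) i)
    have := nonneg_of_superharmonic (h := -u) hG (j := j) (by simp [hj])
      (fun i hij => by simp [mulVec_neg, hL i hij]) i
    simpa using this
  · intro i hij
    rw [sum_walkMatrix_mul (hd i), lapMatrix_mulVec_hit hG hij, div_self (hd' i)]
    ring

theorem volume_pos (hG : G.Connected) (hd : ∀ i, G.degree i ≠ 0) : 0 < volume G := by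
  have := hG.nonempty
  exact Finset.sum_pos (fun i _ => by exact_mod_cast Nat.pos_of_ne_zero (hd i)) Finset.univ_nonempty

/-- Reversibility: `d_i P_ik` is the symmetric adjacency matrix. Densities relative to the degree
thus turn stationarity into `L y = 0`, that is, constancy. -/
theorem sum_mul_walkMatrix (hd : ∀ i, G.degree i ≠ 0) (y : V → ℝ) (k : V) :
    vecMul (fun i => G.degree i * y i) (walkMatrix G) k
      = G.degree k * y k - (G.lapMatrix ℝ *ᵥ y) k := by
  have hd' : ∀ i, (G.degree i : ℝ) ≠ 0 := fun i => by exact_mod_cast hd i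
  rw [SimpleGraph.lapMatrix_mulVec_apply, sub_sub_cancel]
  simp only [vecMul, dotProduct, SimpleGraph.neighborFinset_eq_filter, Finset.sum_filter]
  refine Finset.sum_congr rfl fun i _ => ?_
  rw [walkMatrix_apply (hd i), G.adj_comm]
  split_ifs
  · have := hd' i
    field_simp
  · simp

theorem isStationary_walkMatrix_iff (hG : G.Connected) (hd : ∀ i, G.degree i ≠ 0) (π : V → ℝ) :
    IsStationary (walkMatrix G) π ↔ ∀ i, π i = G.degree i / volume G := by
  have hd' : ∀ i, (G.degree i : ℝ) ≠ 0 := fun i => by exact_mod_cast hd i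
  have hv := volume_pos hG hd
  constructor
  · rintro ⟨⟨-, h1⟩, h2⟩ i
    have h3 : π = fun i => G.degree i * (π i / G.degree i) := by
      ext i
      rw [mul_div_cancel₀ _ (hd' i)]
    have h4 : G.lapMatrix ℝ *ᵥ (fun i => π i / G.degree i) = 0 := by
      ext k
      have h5 := sum_mul_walkMatrix hd (fun i => π i / G.degree i) k
      rw [← h3, h2, mul_div_cancel₀ _ (hd' k)] at h5
      simp only [Pi.zero_apply]
      linarith
    rw [SimpleGraph.lapMatrix_mulVec_eq_zero_iff_forall_reachable] at h4
    have h6 : ∀ k, π k = G.degree k * (π i / G.degree i) := by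
      intro k
      rw [← h4 k i (hG.preconnected k i), mul_div_cancel₀ _ (hd' k)]
    rw [Finset.sum_congr rfl fun k _ => h6 k, ← Finset.sum_mul] at h1
    change volume G * _ = 1 at h1
    have := hd' i
    field_simp at h1 ⊢
    linarith
  · intro h
    refine ⟨⟨fun i => ?_, ?_⟩, ?_⟩
    · rw [h i]
      positivity
    · simp only [h, ← Finset.sum_div]
      exact div_self hv.ne'
    · have h3 : π = fun i => G.degree i * (volume G)⁻¹ := by
        ext i
        rw [h i, div_eq_mul_inv]
      ext k
      rw [h3, sum_mul_walkMatrix hd]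
      simp [lapMatrix_mulVec_eq_sum]

theorem degree_ne_zero_of_volume_ne_zero (hG : G.Connected) (h : volume G ≠ 0) (i : V) :
    G.degree i ≠ 0 := by
  obtain ⟨k, -, hk⟩ := Finset.exists_ne_zero_of_sum_ne_zero h
  have hk' : 0 < G.degree k := Nat.pos_of_ne_zero (by exact_mod_cast hk)
  obtain ⟨w, hw⟩ := (G.degree_pos_iff_exists_adj k).1 hk'
  have : Nontrivial V := ⟨k, w, hw.ne⟩
  exact (hG.preconnected.degree_pos_of_nontrivial i).ne'

theorem degree_eq_zero_of_volume_eq_zero (h : volume G = 0) (i : V) : (G.degree i : ℝ) = 0 :=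
  (Finset.sum_eq_zero_iff_of_nonneg fun _ _ => Nat.cast_nonneg _).1 h i (Finset.mem_univ i)

/-- The two terms involving `i` cancel on exchanging summation indices, which is why Kemeny's
constant does not depend on the start. -/
theorem sum_degree_mul_hit (G : SimpleGraph V) (i : V) :
    ∑ j, (G.degree j : ℝ) * hit G i j = volume G * ∑ j, G.degree j * green G j j
      - ∑ j, ∑ k, (G.degree j : ℝ) * G.degree k * green G j k := by
  have h1 : ∑ j, (G.degree j : ℝ) * hit G i j
      = (∑ j, ∑ k, (G.degree j : ℝ) * G.degree k * green G i k)
        - (∑ j, ∑ k, (G.degree j : ℝ) * G.degree k * green G i j)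
        - (∑ j, ∑ k, (G.degree j : ℝ) * G.degree k * green G j k)
        + ∑ j, ∑ k, (G.degree j : ℝ) * G.degree k * green G j j := by
    simp only [hit, Finset.mul_sum, ← Finset.sum_sub_distrib, ← Finset.sum_add_distrib]
    exact Finset.sum_congr rfl fun j _ => Finset.sum_congr rfl fun k _ => by ring
  have h2 : (∑ j, ∑ k, (G.degree j : ℝ) * G.degree k * green G i k)
      = ∑ j, ∑ k, (G.degree j : ℝ) * G.degree k * green G i j := by
    rw [Finset.sum_comm]
    exact Finset.sum_congr rfl fun j _ => Finset.sum_congr rfl fun k _ => by ring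
  have h3 : ∑ j, ∑ k, (G.degree j : ℝ) * G.degree k * green G j j
      = volume G * ∑ j, G.degree j * green G j j := by
    rw [volume, Finset.sum_mul_sum, Finset.sum_comm]
    exact Finset.sum_congr rfl fun j _ => Finset.sum_congr rfl fun k _ => by ring
  rw [h1, h2, h3]
  ring

/-- The factor `volume G` lets the one-vertex graph, of volume zero, be included. Otherwise the
stationary distribution and the hitting times are unique, so the chosen constant is this sum. -/
theorem volume_mul_kemeny (hG : G.Connected) (i : V) :
    volume G * kemeny G = ∑ j, (G.degree j : ℝ) * hit G i j := by
  by_cases hv : volume G = 0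
  · simp [hv, degree_eq_zero_of_volume_eq_zero hv]
  have hd := degree_ne_zero_of_volume_ne_zero hG hv
  have hex : ∃ κ, IsKemenyConstant (walkMatrix G) κ := by
    refine ⟨(∑ j, (G.degree j : ℝ) * hit G i j) / volume G, fun j => G.degree j / volume G, hit G,
      (isStationary_walkMatrix_iff hG hd _).2 fun _ => rfl, isHittingTime_hit hG hd, fun k => ?_⟩
    rw [sum_degree_mul_hit G i, ← sum_degree_mul_hit G k, Finset.sum_div]
    exact Finset.sum_congr rfl fun j _ => by ring
  obtain ⟨π, m, hπ, hm, hκ⟩ := Classical.epsilon_spec hex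
  change ∀ i, ∑ j, π j * m i j = kemeny G at hκ
  rw [← hκ i, Finset.mul_sum]
  refine Finset.sum_congr rfl fun j _ => ?_
  rw [(isStationary_walkMatrix_iff hG hd π).1 hπ j, (hm i j).2.unique (isHittingTime_hit hG hd i j).2]
  field_simp

theorem two_mul_volume_mul_kemeny (hG : G.Connected) :
    2 * (volume G * kemeny G) = ∑ i, ∑ j, (G.degree i : ℝ) * (G.degree j * effRes G i j) := by
  obtain ⟨i⟩ := hG.nonempty
  rw [volume_mul_kemeny hG i, sum_degree_mul_hit]
  have h1 : ∑ i, ∑ j, (G.degree i : ℝ) * (G.degree j * effRes G i j)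
      = (∑ i, ∑ j, (G.degree j : ℝ) * (G.degree i * green G i i))
        + (∑ i, ∑ j, (G.degree i : ℝ) * (G.degree j * green G j j))
        - 2 * ∑ i, ∑ j, (G.degree i : ℝ) * G.degree j * green G i j := by
    simp only [Finset.mul_sum, ← Finset.sum_sub_distrib, ← Finset.sum_add_distrib]
    refine Finset.sum_congr rfl fun j _ => Finset.sum_congr rfl fun k _ => ?_
    rw [effRes_eq_green hG]
    ring
  have h2 : ∑ i, ∑ j, (G.degree i : ℝ) * (G.degree j * green G j j)
      = volume G * ∑ j, G.degree j * green G j j := by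
    rw [volume, Finset.sum_mul_sum]
  rw [h1, Finset.sum_comm (f := fun i j => (G.degree j : ℝ) * (G.degree i * green G i i)), h2]
  ring

theorem hit_add_hit (hG : G.Connected) (i j : V) :
    hit G i j + hit G j i = volume G * effRes G i j := by
  rw [effRes_eq_green hG, volume, Finset.sum_mul, hit, hit, ← Finset.sum_add_distrib]
  refine Finset.sum_congr rfl fun k _ => ?_
  rw [green_symm G j i]
  ring

/-- The moment times the volume sums commute times to `v`; dropping the nonnegative leg from `j` to
`v` leaves Kemeny's sum started at `v`. -/
theorem volume_mul_kemeny_le_moment (hG : G.Connected) (v : V) :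
    volume G * kemeny G ≤ volume G * moment G v := by
  rw [volume_mul_kemeny hG v, moment, Finset.mul_sum]
  refine Finset.sum_le_sum fun j _ => ?_
  rw [mul_left_comm, ← hit_add_hit hG]
  have := hit_nonneg hG j v
  gcongr
  linarith

end Walk

end KemenyBraess

namespace KemenyBraess

open Classical Matrix

/-! ### Adjacency, connectedness and added edges in a 1-sum. -/

section GlueStructure

variable {V₁ V₂ : Type*} {v₁ : V₁} {v₂ : V₂}

theorem glueLeft_self : glueLeft v₁ v₂ v₁ = Sum.inr v₂ := dif_pos rfl

theorem glueLeft_coe (x : {x : V₁ // x ≠ v₁}) : glueLeft v₁ v₂ x = Sum.inl x := dif_neg x.2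

theorem glueLeft_eq_inl {i : V₁} {x : {x : V₁ // x ≠ v₁}} :
    glueLeft v₁ v₂ i = Sum.inl x ↔ i = x := by
  by_cases h : i = v₁
  · subst h
    simp [glueLeft_self, x.2.symm]
  · simp [glueLeft, h, Subtype.ext_iff]

theorem glueLeft_eq_inr {i : V₁} {y : V₂} :
    glueLeft v₁ v₂ i = Sum.inr y ↔ i = v₁ ∧ y = v₂ := by
  by_cases h : i = v₁
  · subst h
    simp [glueLeft_self, eq_comm]
  · simp [glueLeft, h]

variable {G₁ : SimpleGraph V₁} {G₂ : SimpleGraph V₂}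

theorem oneSum_adj (w w' : {x : V₁ // x ≠ v₁} ⊕ V₂) :
    (oneSum G₁ v₁ G₂ v₂).Adj w w' ↔
      w ≠ w' ∧ ((∃ i k, G₁.Adj i k ∧ glueLeft v₁ v₂ i = w ∧ glueLeft v₁ v₂ k = w') ∨
        ∃ i k, G₂.Adj i k ∧ Sum.inr i = w ∧ Sum.inr k = w') := by
  rw [oneSum, SimpleGraph.sup_adj, SimpleGraph.map_adj', SimpleGraph.map_adj', ← and_or_left]

theorem oneSum_adj_inl_inl (x y : {x : V₁ // x ≠ v₁}) :
    (oneSum G₁ v₁ G₂ v₂).Adj (Sum.inl x) (Sum.inl y) ↔ G₁.Adj x y := by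
  rw [oneSum_adj]
  simp only [glueLeft_eq_inl, reduceCtorEq, and_false, exists_false, or_false]
  constructor
  · rintro ⟨-, i, k, h, rfl, rfl⟩
    exact h
  · intro h
    exact ⟨fun e => h.ne (congrArg Subtype.val (Sum.inl.inj e)), _, _, h, rfl, rfl⟩

theorem oneSum_adj_inl_inr (x : {x : V₁ // x ≠ v₁}) (y : V₂) :
    (oneSum G₁ v₁ G₂ v₂).Adj (Sum.inl x) (Sum.inr y) ↔ y = v₂ ∧ G₁.Adj x v₁ := by
  rw [oneSum_adj]
  simp only [glueLeft_eq_inl, glueLeft_eq_inr, reduceCtorEq, and_false, false_and, exists_false,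
    or_false, ne_eq, not_false_eq_true, true_and]
  constructor
  · rintro ⟨i, k, h, rfl, rfl, rfl⟩
    exact ⟨rfl, h⟩
  · rintro ⟨rfl, h⟩
    exact ⟨_, _, h, rfl, rfl, rfl⟩

theorem oneSum_adj_inr_inl (x : {x : V₁ // x ≠ v₁}) (y : V₂) :
    (oneSum G₁ v₁ G₂ v₂).Adj (Sum.inr y) (Sum.inl x) ↔ y = v₂ ∧ G₁.Adj v₁ x := by
  rw [SimpleGraph.adj_comm, oneSum_adj_inl_inr, SimpleGraph.adj_comm]

theorem oneSum_adj_inr_inr (x y : V₂) :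
    (oneSum G₁ v₁ G₂ v₂).Adj (Sum.inr x) (Sum.inr y) ↔ G₂.Adj x y := by
  rw [oneSum_adj]
  simp only [glueLeft_eq_inr, Sum.inr.injEq]
  constructor
  · rintro ⟨-, ⟨i, k, h, ⟨rfl, rfl⟩, rfl, rfl⟩ | ⟨i, k, h, rfl, rfl⟩⟩
    · exact absurd rfl h.ne
    · exact h
  · intro h
    exact ⟨fun e => h.ne (Sum.inr.inj e), Or.inr ⟨_, _, h, rfl, rfl⟩⟩

theorem connected_oneSum (hG₁ : G₁.Connected) (hG₂ : G₂.Connected) :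
    (oneSum G₁ v₁ G₂ v₂).Connected := by
  have hl : ∀ i k, G₁.Adj i k →
      (oneSum G₁ v₁ G₂ v₂).Adj (glueLeft v₁ v₂ i) (glueLeft v₁ v₂ k) := by
    intro i k h
    rw [oneSum_adj]
    refine ⟨fun e => h.ne ?_, Or.inl ⟨i, k, h, rfl, rfl⟩⟩
    by_cases hk : k = v₁
    · subst hk
      rw [glueLeft_self, glueLeft_eq_inr] at e
      exact e.1
    · have hk' := glueLeft_coe (v₂ := v₂) (⟨k, hk⟩ : {x : V₁ // x ≠ v₁})
      rw [hk', glueLeft_eq_inl] at e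
      exact e
  let f₁ : G₁ →g oneSum G₁ v₁ G₂ v₂ := ⟨glueLeft v₁ v₂, fun h => hl _ _ h⟩
  let f₂ : G₂ →g oneSum G₁ v₁ G₂ v₂ := ⟨Sum.inr, fun h => (oneSum_adj_inr_inr _ _).2 h⟩
  refine (SimpleGraph.connected_iff_exists_forall_reachable _).2 ⟨Sum.inr v₂, ?_⟩
  rintro (x | y)
  · have h := (hG₁.preconnected v₁ x).map f₁
    change (oneSum G₁ v₁ G₂ v₂).Reachable (glueLeft v₁ v₂ v₁) (glueLeft v₁ v₂ x) at h
    rwa [glueLeft_self, glueLeft_coe] at h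
  · exact (hG₂.preconnected v₂ y).map f₂

theorem addEdges_oneSum (S : Set (Sym2 V₂)) :
    addEdges (oneSum G₁ v₁ G₂ v₂) (liftPairs v₁ S) = oneSum G₁ v₁ (addEdges G₂ S) v₂ := by
  have hmem : ∀ w w' : {x : V₁ // x ≠ v₁} ⊕ V₂, s(w, w') ∈ liftPairs v₁ S ↔
      ∃ i k, s(i, k) ∈ S ∧ Sum.inr i = w ∧ Sum.inr k = w' := by
    intro w w'
    constructor
    · rintro ⟨p, hp, h⟩
      induction p with | _ i k =>
      rw [Sym2.map_mk, Sym2.eq_iff] at h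
      rcases h with ⟨h1, h2⟩ | ⟨h1, h2⟩
      · exact ⟨i, k, hp, h1, h2⟩
      · exact ⟨k, i, Sym2.eq_swap ▸ hp, h2, h1⟩
    · rintro ⟨i, k, h, rfl, rfl⟩
      exact ⟨_, h, rfl⟩
  ext w w'
  simp only [addEdges, SimpleGraph.sup_adj, SimpleGraph.fromEdgeSet_adj, hmem]
  rcases w with x | x <;> rcases w' with y | y <;>
    simp [oneSum_adj_inl_inl, oneSum_adj_inl_inr, oneSum_adj_inr_inl, oneSum_adj_inr_inr]

theorem liftPairs_subset {S : Set (Sym2 V₂)} (hS : S ⊆ G₂ᶜ.edgeSet) :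
    liftPairs v₁ S ⊆ (oneSum G₁ v₁ G₂ v₂)ᶜ.edgeSet := by
  rintro _ ⟨p, hp, rfl⟩
  induction p with | _ i k =>
  have h := hS hp
  rw [SimpleGraph.mem_edgeSet, SimpleGraph.compl_adj] at h
  rw [Sym2.map_mk, SimpleGraph.mem_edgeSet, SimpleGraph.compl_adj, oneSum_adj_inr_inr]
  exact ⟨fun e => h.1 (Sum.inr.inj e), h.2⟩

end GlueStructure

/-! ### Resistances and Kemeny's constant of a 1-sum. -/

section GlueSums

variable {V₁ V₂ : Type*} [Fintype V₁] [Fintype V₂] {G₁ : SimpleGraph V₁} {G₂ : SimpleGraph V₂}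
  {v₁ : V₁} {v₂ : V₂}

/-- Each edge of the 1-sum comes from exactly one summand. Degree sums and Laplacian forms are both
sums over adjacent ordered pairs, so both split by this identity. -/
theorem sum_adj_oneSum (F : {x : V₁ // x ≠ v₁} ⊕ V₂ → {x : V₁ // x ≠ v₁} ⊕ V₂ → ℝ) :
    ∑ w, ∑ w', (if (oneSum G₁ v₁ G₂ v₂).Adj w w' then F w w' else 0)
      = (∑ i, ∑ k, if G₁.Adj i k then F (glueLeft v₁ v₂ i) (glueLeft v₁ v₂ k) else 0)
        + ∑ i, ∑ k, if G₂.Adj i k then F (Sum.inr i) (Sum.inr k) else 0 := by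
  simp only [Fintype.sum_sum_type, oneSum_adj_inl_inl, oneSum_adj_inl_inr, oneSum_adj_inr_inl,
    oneSum_adj_inr_inr, ite_and, Finset.sum_ite_eq', Finset.mem_univ, if_true,
    Finset.sum_add_distrib, Fintype.sum_eq_add_sum_subtype_ne _ v₁, glueLeft_self, glueLeft_coe,
    SimpleGraph.irrefl, if_false, zero_add]
  have h : ∑ y : V₂, ∑ x : {x : V₁ // x ≠ v₁},
      (if y = v₂ then if G₁.Adj v₁ x then F (Sum.inr y) (Sum.inl x) else 0 else 0)
        = ∑ x : {x : V₁ // x ≠ v₁}, if G₁.Adj v₁ x then F (Sum.inr v₂) (Sum.inl x) else 0 := by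
    rw [Finset.sum_comm]
    simp
  rw [h]
  ring

theorem sum_degree_mul (G : SimpleGraph V₂) (f : V₂ → ℝ) :
    ∑ i, (G.degree i : ℝ) * f i = ∑ i, ∑ k, if G.Adj i k then f i else 0 := by
  refine Finset.sum_congr rfl fun i _ => ?_
  rw [G.degree_eq_sum_if_adj, Finset.sum_mul]
  exact Finset.sum_congr rfl fun k _ => by split_ifs <;> simp

theorem dotProduct_lapMatrix_mulVec {_ : DecidableEq V₂} (G : SimpleGraph V₂) (g y : V₂ → ℝ) :
    g ⬝ᵥ G.lapMatrix ℝ *ᵥ y = ∑ i, ∑ k, if G.Adj i k then g i * (y i - y k) else 0 := by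
  refine Finset.sum_congr rfl fun i _ => ?_
  rw [SimpleGraph.lapMatrix_mulVec_apply, ← SimpleGraph.card_neighborFinset_eq_degree,
    ← nsmul_eq_mul, ← Finset.sum_const, ← Finset.sum_sub_distrib,
    SimpleGraph.neighborFinset_eq_filter, Finset.sum_filter,
    Finset.mul_sum]
  exact Finset.sum_congr rfl fun k _ => by split_ifs <;> simp

theorem sum_degree_oneSum (f : {x : V₁ // x ≠ v₁} ⊕ V₂ → ℝ) :
    ∑ w, ((oneSum G₁ v₁ G₂ v₂).degree w : ℝ) * f w
      = (∑ i, (G₁.degree i : ℝ) * f (glueLeft v₁ v₂ i))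
        + ∑ i, (G₂.degree i : ℝ) * f (Sum.inr i) := by
  rw [sum_degree_mul, sum_degree_mul, sum_degree_mul, ← sum_adj_oneSum fun w _ => f w]

theorem lapMatrix_oneSum_mulVec {_ : DecidableEq ({x : V₁ // x ≠ v₁} ⊕ V₂)} {y₁ : V₁ → ℝ} {y₂ : V₂ → ℝ} (hy : y₁ v₁ = y₂ v₂)
    (g : {x : V₁ // x ≠ v₁} ⊕ V₂ → ℝ) :
    g ⬝ᵥ (oneSum G₁ v₁ G₂ v₂).lapMatrix ℝ *ᵥ (Sum.elim (fun x => y₁ x) y₂)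
      = (g ∘ glueLeft v₁ v₂) ⬝ᵥ G₁.lapMatrix ℝ *ᵥ y₁
        + (g ∘ Sum.inr) ⬝ᵥ G₂.lapMatrix ℝ *ᵥ y₂ := by
  have h1 : ∀ i, Sum.elim (fun x : {x : V₁ // x ≠ v₁} => y₁ x) y₂ (glueLeft v₁ v₂ i) = y₁ i := by
    intro i
    by_cases h : i = v₁
    · subst h
      simp [glueLeft_self, hy]
    · simp [glueLeft, h]
  rw [dotProduct_lapMatrix_mulVec, dotProduct_lapMatrix_mulVec, dotProduct_lapMatrix_mulVec,
    sum_adj_oneSum]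
  simp only [h1, Sum.elim_inr, Function.comp_apply]

theorem effRes_comm {V : Type*} [Fintype V] {G : SimpleGraph V} (hG : G.Connected) (i j : V) :
    effRes G i j = effRes G j i := by
  rw [effRes_eq_green hG, effRes_eq_green hG, green_symm G i j]
  ring

/-- The potential on `G₁` is extended by its value at the cut vertex: no current enters `G₂`. -/
theorem effRes_oneSum_left (hG₁ : G₁.Connected) (hG₂ : G₂.Connected) (i k : V₁) :
    effRes (oneSum G₁ v₁ G₂ v₂) (glueLeft v₁ v₂ i) (glueLeft v₁ v₂ k) = effRes G₁ i k := by
  obtain ⟨y, hy⟩ := exists_potential hG₁ i k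
  have hv : ∀ i, Sum.elim (fun x : {x : V₁ // x ≠ v₁} => y x) (fun _ : V₂ => y v₁)
      (glueLeft v₁ v₂ i) = y i := by
    intro i
    by_cases h : i = v₁
    · subst h
      simp [glueLeft_self]
    · simp [glueLeft, h]
  rw [effRes_eq_of_potential hG₁ hy, effRes_eq_of_potential (connected_oneSum hG₁ hG₂)
    (y := Sum.elim (fun x => y x) (fun _ => y v₁)), hv, hv]
  refine dotProduct_eq _ _ fun g => ?_
  rw [dotProduct_comm, lapMatrix_oneSum_mulVec (y₁ := y) (y₂ := fun _ => y v₁) rfl, hy]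
  simp [dotProduct_lapMatrix_mulVec, sub_dotProduct, dotProduct_sub]

theorem effRes_oneSum_right (hG₁ : G₁.Connected) (hG₂ : G₂.Connected) (i k : V₂) :
    effRes (oneSum G₁ v₁ G₂ v₂) (Sum.inr i) (Sum.inr k) = effRes G₂ i k := by
  obtain ⟨y, hy⟩ := exists_potential hG₂ i k
  rw [effRes_eq_of_potential hG₂ hy, effRes_eq_of_potential (connected_oneSum hG₁ hG₂)
    (y := Sum.elim (fun _ => y v₂) y)]
  · simp
  refine dotProduct_eq _ _ fun g => ?_
  rw [dotProduct_comm, lapMatrix_oneSum_mulVec (y₁ := fun _ => y v₂) rfl, hy]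
  simp [dotProduct_lapMatrix_mulVec, sub_dotProduct, dotProduct_sub]

/-- Series law: the unit current from `i` to `k` passes through the cut vertex, where the sink of
one potential cancels the source of the other. -/
theorem effRes_oneSum_mixed (hG₁ : G₁.Connected) (hG₂ : G₂.Connected) (i : V₁) (k : V₂) :
    effRes (oneSum G₁ v₁ G₂ v₂) (glueLeft v₁ v₂ i) (Sum.inr k)
      = effRes G₁ i v₁ + effRes G₂ k v₂ := by
  obtain ⟨y, hy⟩ := exists_potential hG₁ i v₁
  obtain ⟨z, hz⟩ := exists_potential hG₂ v₂ k
  -- The constant shift, invisible to the Laplacian, makes the potentials agree at the common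
  -- vertex.
  have hz' : G₂.lapMatrix ℝ *ᵥ (fun j => z j - z v₂ + y v₁) = Pi.single v₂ 1 - Pi.single k 1 := by
    rw [← hz]
    ext j
    simp [lapMatrix_mulVec_eq_sum]
  have hv : ∀ i, Sum.elim (fun x : {x : V₁ // x ≠ v₁} => y x) (fun j => z j - z v₂ + y v₁)
      (glueLeft v₁ v₂ i) = y i := by
    intro i
    by_cases h : i = v₁
    · subst h
      simp [glueLeft_self]
    · simp [glueLeft, h]
  rw [effRes_comm hG₂, effRes_eq_of_potential hG₁ hy, effRes_eq_of_potential hG₂ hz,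
    effRes_eq_of_potential (connected_oneSum hG₁ hG₂)
    (y := Sum.elim (fun x => y x) (fun j => z j - z v₂ + y v₁)), hv]
  · simp
    ring
  refine dotProduct_eq _ _ fun g => ?_
  rw [dotProduct_comm, lapMatrix_oneSum_mulVec (by simp), hy, hz']
  simp [sub_dotProduct, dotProduct_sub, glueLeft_self]

theorem volume_oneSum : volume (oneSum G₁ v₁ G₂ v₂) = volume G₁ + volume G₂ := by
  simpa [volume] using sum_degree_oneSum (G₁ := G₁) (G₂ := G₂) (v₁ := v₁) (v₂ := v₂) fun _ => 1

/-- Kemeny's constant of a 1-sum. -/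
theorem volume_mul_kemeny_oneSum (hG₁ : G₁.Connected) (hG₂ : G₂.Connected) :
    (volume G₁ + volume G₂) * kemeny (oneSum G₁ v₁ G₂ v₂)
      = volume G₁ * kemeny G₁ + volume G₂ * kemeny G₂
        + volume G₂ * moment G₁ v₁ + volume G₁ * moment G₂ v₂ := by
  have hG := connected_oneSum (v₁ := v₁) (v₂ := v₂) hG₁ hG₂
  have h := two_mul_volume_mul_kemeny hG
  have h1 := two_mul_volume_mul_kemeny hG₁
  have h2 := two_mul_volume_mul_kemeny hG₂
  simp only [← Finset.mul_sum] at h h1 h2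
  -- The double sum splits into four blocks: one within each summand and two equal mixed ones.
  rw [sum_degree_oneSum] at h
  simp only [sum_degree_oneSum, effRes_oneSum_left hG₁ hG₂, effRes_oneSum_right hG₁ hG₂,
    effRes_oneSum_mixed hG₁ hG₂,
    fun i k => effRes_comm hG (Sum.inr k) (glueLeft v₁ v₂ i), mul_add, Finset.sum_add_distrib] at h
  rw [← h1, ← h2, volume_oneSum] at h
  have e1 : ∀ (i : V₁), ∑ j, (G₂.degree j : ℝ) * effRes G₁ i v₁ = volume G₂ * effRes G₁ i v₁ :=
    fun i => by rw [volume, Finset.sum_mul]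
  have e2 : ∀ (i : V₂), ∑ j, (G₁.degree j : ℝ) * effRes G₂ i v₂ = volume G₁ * effRes G₂ i v₂ :=
    fun i => by rw [volume, Finset.sum_mul]
  have e3 : ∀ c, ∑ j, (G₁.degree j : ℝ) * c = volume G₁ * c := fun c => by
    rw [volume, Finset.sum_mul]
  have e4 : ∀ c, ∑ j, (G₂.degree j : ℝ) * c = volume G₂ * c := fun c => by
    rw [volume, Finset.sum_mul]
  simp only [e1, e2, e3, e4, mul_left_comm _ (volume _) _, ← Finset.mul_sum] at h
  change _ = _ + (volume G₂ * moment G₁ v₁ + volume G₁ * moment G₂ v₂) +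
    (volume G₂ * moment G₁ v₁ + volume G₁ * moment G₂ v₂ + _) at h
  linarith

theorem volume_eq_two_mul_ncard {V : Type*} [Fintype V] (G : SimpleGraph V) :
    volume G = 2 * (G.edgeSet.ncard : ℝ) := by
  have h := G.sum_degrees_eq_twice_card_edges
  rw [volume, ← Nat.cast_sum, h, ← SimpleGraph.coe_edgeFinset, Set.ncard_coe_finset]
  push_cast
  rfl

theorem ncard_edgeSet_addEdges {V : Type*} [Fintype V] (G : SimpleGraph V) {S : Set (Sym2 V)}
    (hS : S ⊆ Gᶜ.edgeSet) :
    (addEdges G S).edgeSet.ncard = G.edgeSet.ncard + S.ncard := by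
  have h1 : (addEdges G S).edgeSet = G.edgeSet ∪ S := by
    rw [addEdges, SimpleGraph.edgeSet_sup, SimpleGraph.edgeSet_fromEdgeSet, sdiff_eq_left.2]
    exact Set.disjoint_left.2 fun e he hd => SimpleGraph.not_isDiag_of_mem_edgeSet _ (hS he) hd
  rw [h1, Set.ncard_union_eq _ (Set.toFinite _) (Set.toFinite _)]
  refine Set.disjoint_left.2 fun e he hd => ?_
  have := hS hd
  induction e with | _ i k =>
  rw [SimpleGraph.mem_edgeSet, SimpleGraph.compl_adj] at this
  exact this.2 he

end GlueSums

end KemenyBraess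

/-! ### Comparison of Kemeny's constants before and after the edges are added. -/

open KemenyBraess in
open Classical in
theorem mainTheorem6 {V₁ V₂ : Type*} [Fintype V₁] [Fintype V₂]
    (G₁ : SimpleGraph V₁) (G₂ : SimpleGraph V₂)
    (hG₁ : G₁.Connected) (hG₂ : G₂.Connected) (v₁ : V₁) (v₂ : V₂)
    (L : Set (Sym2 V₂)) (hL : L ⊆ G₂ᶜ.edgeSet)
    (m₁ m₂ l A B C : ℝ)
    (hm₁ : m₁ = G₁.edgeSet.ncard) (hm₂ : m₂ = G₂.edgeSet.ncard) (hl : l = L.ncard)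
    (hA : A = moment (addEdges G₂ L) v₂ - moment G₂ v₂)
    (hB : B = kemeny (addEdges G₂ L) - moment G₂ v₂)
    (hC : C = kemeny (addEdges G₂ L) - kemeny G₂)
    (hpos : A * m₁ ^ 2 + ((A + C) * m₂ + B * l) * m₁ + C * (m₂ ^ 2 + l * m₂) > 0) :
    IsBraessSet (oneSum G₁ v₁ G₂ v₂) (liftPairs v₁ L) := by
  refine ⟨liftPairs_subset hL, ?_⟩
  rw [addEdges_oneSum]
  have hG₂' : (addEdges G₂ L).Connected := hG₂.mono le_sup_left
  have k := volume_mul_kemeny_oneSum (v₁ := v₁) (v₂ := v₂) hG₁ hG₂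
  have k' := volume_mul_kemeny_oneSum (v₁ := v₁) (v₂ := v₂) hG₁ hG₂'
  have hle := volume_mul_kemeny_le_moment hG₁ v₁
  rw [volume_eq_two_mul_ncard, ← hm₁] at hle
  rw [volume_eq_two_mul_ncard, volume_eq_two_mul_ncard, ← hm₁, ← hm₂] at k
  rw [volume_eq_two_mul_ncard, volume_eq_two_mul_ncard, ncard_edgeSet_addEdges G₂ hL, Nat.cast_add,
    ← hm₁, ← hm₂, ← hl] at k'
  have hm₁0 : 0 ≤ m₁ := hm₁ ▸ Nat.cast_nonneg _
  have hm₂0 : 0 ≤ m₂ := hm₂ ▸ Nat.cast_nonneg _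
  have hl0 : 0 ≤ l := hl ▸ Nat.cast_nonneg _
  -- If neither graph had an edge, the polynomial in `hpos` would be zero.
  have hm : 0 < m₁ + m₂ := by
    by_contra! h
    have h1 : m₁ = 0 := by linarith
    have h2 : m₂ = 0 := by linarith
    simp [h1, h2] at hpos
  set K := kemeny (oneSum G₁ v₁ G₂ v₂)
  set K' := kemeny (oneSum G₁ v₁ (addEdges G₂ L) v₂)
  -- Cross-multiplying the two 1-sum formulas leaves `-l m₁` on `kemeny G₁`, and `(m₂+l)(m₁+m₂) -
  -- m₂(m₁+m₂+l) = l m₁` on `moment G₁ v₁`. The halves undo `volume = 2m`.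
  have key : (m₁ + m₂) * (m₁ + m₂ + l) * (K' - K)
      = A * m₁ ^ 2 + ((A + C) * m₂ + B * l) * m₁ + C * (m₂ ^ 2 + l * m₂)
        + l * (m₁ * moment G₁ v₁ - m₁ * kemeny G₁) := by
    rw [hA, hB, hC]
    linear_combination ((m₁ + m₂) / 2) * k' - ((m₁ + m₂ + l) / 2) * k
  have hge : 0 ≤ l * (m₁ * moment G₁ v₁ - m₁ * kemeny G₁) := mul_nonneg hl0 (by linarith)
  have hprod : 0 < (m₁ + m₂) * (m₁ + m₂ + l) * (K' - K) := by linarith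
  have := (mul_pos_iff_of_pos_left (by positivity)).1 hprod
  linarith
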